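/- Let $L^2[0,1]$ be the real Hilbert space of square-integrable functions on $[0,1]$, with identity operator $I$. An integral operator on $L^2[0,1]$ with kernel $K$ is the bounded operator $(Kf)(x)=\int_0^1 K(x,y)f(y)\,dy$; the same letter denotes an operator and its kernel, and $^*$ denotes the adjoint. For a continuous kernel $K$ on $[0,1]^2$ the Fredholm determinant is $$\det(I+K)=\sum_{n=0}^\infty\frac1{n!}\int_0^1\cdots\int_0^1\det\bigl[K(x_p,x_q)\bigr]_{p,q=1}^n\,dx_1\cdots dx_n .$$ **Theorem.** Let $A$ be an integral operator on $L^2[0,1]$ with kernel continuous on $[0,1]^2$. Suppose that $I+A=(I+T)(I+T^*)$, where $T$ is an integral operator on $L^2[0,1]$ whose kernel satisfies $T(x,y)=0$ for $x<y$ and is continuous on the closed triangle $\{(x,y): 0\le y\le x\le 1\}$ (it need not be continuous on $[0,1]^2$). Then the series defining $\det(I+A)$ converges absolutely, $\det(I+A)>0$, and $$\log\det(I+A)=\int_0^1 T(t,t)\,dt .$$ -/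

import Mathlib

open MeasureTheory

noncomputable section

/-- The real Hilbert space `L²[0,1]` (Lebesgue measure on the unit interval). -/
abbrev L2I : Type := Lp ℝ 2 (volume : Measure unitInterval)

/-- `A` is the integral operator on `L²[0,1]` with kernel `K`: the kernel is measurable and
`(A f)(x) = ∫₀¹ K(x,y) f(y) dy` for almost every `x`, where the integral converges absolutely. -/
structure IsIntegralOperator (A : L2I →L[ℝ] L2I) (K : unitInterval → unitInterval → ℝ) : Prop where
  aestronglyMeasurable :
    AEStronglyMeasurable (Function.uncurry K) (volume : Measure (unitInterval × unitInterval))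
  integrable : ∀ f : L2I, ∀ᵐ x : unitInterval, Integrable (fun y : unitInterval => K x y * f y)
  apply_ae : ∀ f : L2I, ∀ᵐ x : unitInterval, A f x = ∫ y : unitInterval, K x y * f y

/-- A (lower) triangular kernel: `K(x,y) = 0` strictly above the diagonal, i.e. for `x < y`. -/
def IsTriangularKernel (K : unitInterval → unitInterval → ℝ) : Prop :=
  ∀ x y : unitInterval, x < y → K x y = 0

/-- The `n`-th term `(1/n!) ∫_{[0,1]^n} det [K(x_p, x_q)]_{p,q} dx` of the Fredholm series. -/
def fredholmTerm (K : unitInterval → unitInterval → ℝ) (n : ℕ) : ℝ :=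
  (1 / (n.factorial : ℝ)) *
    ∫ x : Fin n → unitInterval, (Matrix.of fun p q : Fin n => K (x p) (x q)).det

/-- The Fredholm determinant `det(I + K)` of the integral operator with kernel `K`. -/
def fredholmDet (K : unitInterval → unitInterval → ℝ) : ℝ :=
  ∑' n : ℕ, fredholmTerm K n

end

/-! The kernel of `T` jumps across the diagonal, where the Fredholm determinant reads its values, so
the factorization is discretized instead of taking determinants of its factors. Let `H` be the
symmetric continuous extension of `kT` from the triangle. Expanding `A = T + T* + T T*` and using
continuity, `kA` is `factoredKernel H` everywhere (`kernel_eq_factoredKernel`). On a uniform grid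
with weight `c = 1/(N+1)`, let `L` be the lower triangular samples of `H` with halved diagonal. Then
`L + Lᵀ` samples `H` exactly, and `1 + c(L + Lᵀ + c L Lᵀ) = (1 + cL)(1 + cL)ᵀ` has determinant `∏ (1
+ c H(tᵢ,tᵢ)/2)²`, which tends to `exp ∫ H(t,t) dt`. The left side is the Fredholm determinant of a
step kernel (`fredholmDet_gridCell`). These kernels are bounded and converge pointwise to
`factoredKernel H`, so Hadamard's bound gives convergence of their determinants
(`tendsto_fredholmDet`). -/

open Filter Topology

/-! ### Hadamard's bound and a summable majorant -/

/-- Hadamard's inequality for a matrix with entries bounded by `B`. -/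
theorem Matrix.abs_det_le_of_abs_le {n : ℕ} (M : Matrix (Fin n) (Fin n) ℝ) {B : ℝ} (hB : 0 ≤ B)
    (hM : ∀ i j, |M i j| ≤ B) : |M.det| ≤ (√n * B) ^ n := by
  let e := EuclideanSpace.basisFun (Fin n) ℝ
  let v : Fin n → EuclideanSpace ℝ (Fin n) := fun i => WithLp.toLp 2 (M i)
  have : Fact (Module.finrank ℝ (EuclideanSpace ℝ (Fin n)) = n) := ⟨by simp⟩
  have h := e.toBasis.orientation.abs_volumeForm_apply_le v
  rw [Orientation.volumeForm_robust _ e rfl] at h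
  have hdet : e.toBasis.det v = M.det := by
    rw [Module.Basis.det_apply, ← Matrix.det_transpose M]
    congr 1
  rw [hdet] at h
  refine h.trans ?_
  have hv : ∀ i, ‖v i‖ ≤ √n * B := by
    intro i
    rw [EuclideanSpace.norm_eq]
    calc √(∑ j, ‖v i j‖ ^ 2) ≤ √(n * B ^ 2) := by
          apply Real.sqrt_le_sqrt
          calc ∑ j, ‖v i j‖ ^ 2 ≤ ∑ _j : Fin n, B ^ 2 := by
                gcongr with j
                exact hM i j
            _ = n * B ^ 2 := by simp
      _ = √n * B := by rw [Real.sqrt_mul (by positivity), Real.sqrt_sq hB]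
  calc ∏ i, ‖v i‖ ≤ ∏ _i : Fin n, (√n * B) :=
        Finset.prod_le_prod (fun i _ => norm_nonneg _) fun i _ => hv i
    _ = (√n * B) ^ n := by simp

/-- Since `n ^ n ≤ e ^ n * n!`, the square of the numerator is at most `(e B²) ^ n * n!`; AM-GM with
weight `4 ^ n` splits its root into two summable pieces. -/
theorem sqrt_mul_pow_div_factorial_le (B : ℝ) (n : ℕ) :
    (√n * B) ^ n / n.factorial ≤
      (1 / 4) ^ n + (4 * Real.exp 1 * B ^ 2) ^ n / n.factorial := by
  have hf : (0 : ℝ) < n.factorial := by positivity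
  have h1 : (n : ℝ) ^ n ≤ Real.exp 1 ^ n * n.factorial := by
    have := Real.pow_div_factorial_le_exp (n : ℝ) (by positivity) n
    rw [div_le_iff₀ hf] at this
    rwa [← Real.exp_nat_mul, mul_one]
  set a : ℝ := (√n * B) ^ n with ha
  have hsq : a ^ 2 ≤ (Real.exp 1 * B ^ 2) ^ n * n.factorial := by
    have : a ^ 2 = (n : ℝ) ^ n * (B ^ 2) ^ n := by
      rw [ha, ← pow_mul, mul_comm n 2, pow_mul, mul_pow, Real.sq_sqrt (by positivity), mul_pow]
    rw [this, mul_pow, mul_right_comm]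
    gcongr
  have h4 : (4 * Real.exp 1 * B ^ 2) ^ n = 4 ^ n * (Real.exp 1 * B ^ 2) ^ n := by
    rw [← mul_pow]; ring
  set c : ℝ := (Real.exp 1 * B ^ 2) ^ n
  have hp : (0 : ℝ) < 4 ^ n := by positivity
  rw [h4, one_div, inv_pow, div_le_iff₀ hf, add_mul, div_mul_cancel₀ _ hf.ne']
  set d : ℝ := (n.factorial : ℝ)
  set p : ℝ := 4 ^ n
  have hkey : a ≤ p⁻¹ * d + p * c := by
    have h2 : p * a ^ 2 ≤ p * (c * d) := by gcongr
    have h3 : 0 ≤ c := by positivity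
    have h5 : a ^ 2 ≤ (p⁻¹ * d + p * c) ^ 2 := by
      have : (p⁻¹ * d + p * c) ^ 2 = (p⁻¹ * d - p * c) ^ 2 + 4 * (c * d) := by
        field_simp
        ring
      rw [this]
      nlinarith [sq_nonneg (p⁻¹ * d - p * c), mul_nonneg h3 hf.le]
    exact le_of_sq_le_sq h5 (by positivity)
  exact hkey

theorem summable_sqrt_mul_pow_div_factorial {B : ℝ} (hB : 0 ≤ B) :
    Summable fun n : ℕ => (√n * B) ^ n / n.factorial :=
  Summable.of_nonneg_of_le (fun n => by positivity) (sqrt_mul_pow_div_factorial_le B)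
    ((summable_geometric_of_lt_one (by norm_num) (by norm_num)).add
      (Real.summable_pow_div_factorial _))

/-! ### Finite Fredholm expansion of a matrix determinant -/

open Finset in
theorem Matrix.sum_det_submatrix {ι : Type*} [Fintype ι] [DecidableEq ι] {R : Type*} [CommRing R]
    (M : Matrix ι ι R) (n : ℕ) :
    ∑ i : Fin n → ι, (M.submatrix i i).det =
      n.factorial * ∑ s ∈ powersetCard n (univ : Finset ι),
        (M.submatrix (↑) (↑) : Matrix s s R).det := by
  have h0 : ∑ i : Fin n → ι, (M.submatrix i i).det =
      ∑ i : Fin n → ι with Function.Injective i, (M.submatrix i i).det := by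
    symm
    apply Finset.sum_filter_of_ne
    intro i _ hi
    contrapose! hi
    obtain ⟨a, b, hab, hne⟩ := Function.not_injective_iff.mp hi
    -- A repeated index repeats a row, so only injective tuples count; each `n`-subset is the image
    -- of `n!` of them, all with the same minor.
    exact Matrix.det_zero_of_row_eq hne (by ext j; simp [hab])
  rw [h0, ← Finset.sum_fiberwise_of_maps_to (g := fun i => univ.image i)
    (t := powersetCard n (univ : Finset ι)), Finset.mul_sum]
  · refine Finset.sum_congr rfl fun s hs => ?_
    have hs : s.card = n := (mem_powersetCard.mp hs).2
    have hcard : Fintype.card (Fin n ≃ s) = n.factorial := by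
      rw [Fintype.card_equiv (Fintype.equivOfCardEq (by simp [hs])), Fintype.card_fin]
    rw [← hcard, ← nsmul_eq_mul, ← Finset.card_univ, ← Finset.sum_const]
    symm
    refine Finset.sum_bij (fun (e : Fin n ≃ s) _ => fun k => (e k : ι)) ?_ ?_ ?_ ?_
    · intro e _
      simp only [mem_filter, mem_univ, true_and]
      refine ⟨Subtype.val_injective.comp e.injective, ?_⟩
      ext x
      simp only [mem_image, mem_univ, true_and]
      exact ⟨fun ⟨k, hk⟩ => hk ▸ (e k).2, fun hx => ⟨e.symm ⟨x, hx⟩, by simp⟩⟩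
    · intro e _ e' _ h
      ext k
      exact congrFun h k
    · intro i hi
      simp only [mem_filter, mem_univ, true_and] at hi
      obtain ⟨hinj, rfl⟩ := hi
      refine ⟨Equiv.ofBijective (fun k => ⟨i k, mem_image_of_mem i (mem_univ k)⟩)
        ⟨fun a b h => hinj (congrArg Subtype.val h), fun ⟨x, hx⟩ => ?_⟩, mem_univ _, rfl⟩
      obtain ⟨k, -, hk⟩ := mem_image.mp hx
      exact ⟨k, Subtype.ext hk⟩
    · intro e _
      rw [← Matrix.det_submatrix_equiv_self e]
      rfl
  · intro i hi
    simp only [mem_filter, mem_univ, true_and] at hi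
    simp [mem_powersetCard, card_image_of_injective _ hi]

theorem Matrix.hasSum_det_one_add_smul {ι : Type*} [Fintype ι] [DecidableEq ι]
    (M : Matrix ι ι ℝ) (c : ℝ) :
    HasSum (fun n : ℕ => 1 / (n.factorial : ℝ) *
      (c ^ n * ∑ i : Fin n → ι, (M.submatrix i i).det)) (1 + c • M).det := by
  set p : Polynomial ℝ := (1 + (Polynomial.X : Polynomial ℝ) • M.map Polynomial.C).det with hp
  have hterm : ∀ n : ℕ, 1 / (n.factorial : ℝ) *
      (c ^ n * ∑ i : Fin n → ι, (M.submatrix i i).det) = p.coeff n * c ^ n := by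
    intro n
    rw [Matrix.sum_det_submatrix, hp, Matrix.coeff_det_one_add_X_smul_eq_sum_minors]
    field_simp
  have heval : (1 + c • M).det = p.eval c := by
    rw [hp, ← Polynomial.coe_evalRingHom, RingHom.map_det]
    congr 1
    ext i j
    rcases eq_or_ne i j with rfl | h
    · simp [mul_comm c]
    · simp [h, mul_comm c]
  simp_rw [hterm]
  rw [heval, Polynomial.eval_eq_sum_range]
  apply hasSum_sum_of_ne_finset_zero
  intro n hn
  rw [Polynomial.coeff_eq_zero_of_natDegree_lt (by simpa [Nat.lt_succ_iff] using hn), zero_mul]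

/-! ### The measure on the unit interval and the uniform grid -/

instance unitInterval.instIsOpenPosMeasureVolume :
    (volume : Measure unitInterval).IsOpenPosMeasure where
  open_pos U hU hne := by
    obtain ⟨V, hV, rfl⟩ := isOpen_induced_iff.mp hU
    obtain ⟨x, hx⟩ := hne
    have hcl : (x : ℝ) ∈ closure (Set.Ioo (0 : ℝ) 1) := by
      rw [closure_Ioo zero_ne_one]
      exact x.2
    have hpos := (hV.inter isOpen_Ioo).measure_pos volume (mem_closure_iff.mp hcl V hV hx)
    rw [unitInterval.volume_apply]
    refine (hpos.trans_le (measure_mono ?_)).ne'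
    rintro y ⟨hyV, hy⟩
    exact ⟨⟨y, hy.1.le, hy.2.le⟩, hyV, rfl⟩

/-- The index of the cell of the uniform partition of `[0,1]` into `N + 1` cells containing `x`. -/
noncomputable def gridCell (N : ℕ) (x : unitInterval) : Fin (N + 1) :=
  -- Cells are open on the left and closed on the right; truncated subtraction puts `0` into the
  -- first cell.
  ⟨⌈((N : ℝ) + 1) * x⌉₊ - 1, by
    have : ⌈((N : ℝ) + 1) * x⌉₊ ≤ N + 1 := by
      rw [Nat.ceil_le]
      push_cast
      exact mul_le_of_le_one_right (by positivity) x.2.2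
    omega⟩

/-- The left end point of a cell of the uniform partition. -/
noncomputable def gridPoint (N : ℕ) (i : Fin (N + 1)) : unitInterval :=
  ⟨i / ((N : ℝ) + 1), by positivity, by
    rw [div_le_one (by positivity)]
    exact_mod_cast i.2.le⟩

theorem gridPoint_strictMono (N : ℕ) : StrictMono (gridPoint N) := by
  intro i j h
  have : (i : ℝ) < j := by exact_mod_cast h
  exact Subtype.coe_lt_coe.mp (div_lt_div_of_pos_right this (by positivity))

theorem gridCell_eq_iff {N : ℕ} {x : unitInterval} (hx : 0 < (x : ℝ)) (i : Fin (N + 1)) :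
    gridCell N x = i ↔ (i : ℝ) < (N + 1) * x ∧ (N + 1) * (x : ℝ) ≤ i + 1 := by
  have hpos : 0 < ⌈((N : ℝ) + 1) * x⌉₊ := Nat.ceil_pos.mpr (by positivity)
  have h := Nat.ceil_eq_iff (a := ((N : ℝ) + 1) * x) (n := i + 1) (by omega)
  rw [Fin.ext_iff]
  change ⌈((N : ℝ) + 1) * x⌉₊ - 1 = i ↔ _
  rw [show (⌈((N : ℝ) + 1) * x⌉₊ - 1 = i ↔ ⌈((N : ℝ) + 1) * x⌉₊ = i + 1) by omega, h]
  simp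

theorem measurable_gridCell (N : ℕ) : Measurable (gridCell N) := by
  have h : Measurable fun x : unitInterval => ⌈((N : ℝ) + 1) * x⌉₊ - 1 := by fun_prop
  refine measurable_to_countable' fun i => ?_
  convert h (measurableSet_singleton (i : ℕ)) using 1
  ext x
  simp [gridCell, Fin.ext_iff]

/-- The uniform probability measure on `Fin (N + 1)`. -/
noncomputable def gridMeasure (N : ℕ) : Measure (Fin (N + 1)) :=
  ENNReal.ofReal ((N : ℝ) + 1)⁻¹ • Measure.count

instance (N : ℕ) : IsFiniteMeasure (gridMeasure N) := by
  refine ⟨?_⟩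
  simp [gridMeasure, ENNReal.mul_lt_top]

theorem gridMeasure_singleton (N : ℕ) (i : Fin (N + 1)) :
    gridMeasure N {i} = ENNReal.ofReal ((N : ℝ) + 1)⁻¹ := by
  simp [gridMeasure]

theorem measurePreserving_gridCell (N : ℕ) :
    MeasurePreserving (gridCell N) volume (gridMeasure N) := by
  refine ⟨measurable_gridCell N, Measure.ext_of_singleton fun i => ?_⟩
  rw [Measure.map_apply (measurable_gridCell N) (measurableSet_singleton i), gridMeasure_singleton]
  have hN : (0 : ℝ) < N + 1 := by positivity
  let b : unitInterval := ⟨((i : ℝ) + 1) / (N + 1), by positivity, by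
    rw [div_le_one hN]
    exact_mod_cast i.2⟩
  have hvol : volume (Set.Ioc (gridPoint N i) b) = ENNReal.ofReal ((N : ℝ) + 1)⁻¹ := by
    rw [unitInterval.volume_Ioc]
    congr 1
    simp only [b, gridPoint]
    field_simp
    ring
  have hiff : ∀ x : unitInterval, 0 < (x : ℝ) →
      (gridCell N x = i ↔ x ∈ Set.Ioc (gridPoint N i) b) := by
    intro x hx
    rw [gridCell_eq_iff hx, Set.mem_Ioc, ← Subtype.coe_lt_coe, ← Subtype.coe_le_coe]
    simp only [b, gridPoint]
    rw [div_lt_iff₀ hN, le_div_iff₀ hN, mul_comm (x : ℝ)]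
  rw [← hvol]
  refine measure_congr ?_
  filter_upwards [compl_mem_ae_iff.mpr (measure_singleton (μ := volume) (0 : unitInterval))]
    with x hx
  exact propext (hiff x (unitInterval.pos_iff_ne_zero.mpr hx))

theorem integral_comp_gridCell (N : ℕ) (f : Fin (N + 1) → ℝ) :
    ∫ x : unitInterval, f (gridCell N x) = ((N : ℝ) + 1)⁻¹ * ∑ i, f i := by
  have h := (measurePreserving_gridCell N).map_eq
  rw [← integral_map (measurable_gridCell N).aemeasurable
    (measurable_of_finite f).aestronglyMeasurable, h, integral_fintype .of_finite, Finset.mul_sum]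
  refine Finset.sum_congr rfl fun i _ => ?_
  rw [Measure.real, gridMeasure_singleton, ENNReal.toReal_ofReal (by positivity), smul_eq_mul]

theorem integral_pi_comp_gridCell (N n : ℕ) (f : (Fin n → Fin (N + 1)) → ℝ) :
    ∫ x : Fin n → unitInterval, f (fun k => gridCell N (x k)) =
      (((N : ℝ) + 1)⁻¹) ^ n * ∑ i, f i := by
  have h := measurePreserving_pi (fun _ : Fin n => (volume : Measure unitInterval))
    (fun _ => gridMeasure N) (fun _ => measurePreserving_gridCell N)
  rw [volume_pi, ← integral_map (φ := fun (x : Fin n → unitInterval) k => gridCell N (x k))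
    h.measurable.aemeasurable
    (measurable_of_finite f).aestronglyMeasurable, h.map_eq, integral_fintype .of_finite,
    Finset.mul_sum]
  refine Finset.sum_congr rfl fun i _ => ?_
  rw [Measure.real, Measure.pi_singleton]
  simp only [gridMeasure_singleton]
  rw [Finset.prod_const, ENNReal.toReal_pow, ENNReal.toReal_ofReal (by positivity), smul_eq_mul]
  simp

/-- For a step kernel each integral is a finite sum over index tuples, so the Fredholm series is the
expansion of the matrix determinant in minors. -/
theorem fredholmDet_gridCell (N : ℕ) (M : Matrix (Fin (N + 1)) (Fin (N + 1)) ℝ) :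
    fredholmDet (fun x y => M (gridCell N x) (gridCell N y)) = (1 + ((N : ℝ) + 1)⁻¹ • M).det := by
  rw [← (Matrix.hasSum_det_one_add_smul M ((N : ℝ) + 1)⁻¹).tsum_eq]
  refine tsum_congr fun n => ?_
  rw [← integral_pi_comp_gridCell N n fun i => (M.submatrix i i).det]
  rfl

theorem tendsto_gridPoint_gridCell (x : unitInterval) :
    Tendsto (fun N => gridPoint N (gridCell N x)) atTop (𝓝 x) := by
  rw [tendsto_iff_dist_tendsto_zero]
  refine squeeze_zero (fun _ => dist_nonneg) (fun N => ?_)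
    (tendsto_one_div_add_atTop_nhds_zero_nat (𝕜 := ℝ))
  have hN : (0 : ℝ) < N + 1 := by positivity
  rw [Subtype.dist_eq, Real.dist_eq]
  rcases x.2.1.eq_or_lt with h0 | h0
  · have : (gridPoint N (gridCell N x) : ℝ) = 0 := by simp [gridPoint, gridCell, ← h0]
    rw [this, ← h0]
    simp only [sub_zero, abs_zero]
    positivity
  · obtain ⟨h1, h2⟩ := (gridCell_eq_iff h0 (gridCell N x)).mp rfl
    have h3 : (gridPoint N (gridCell N x) : ℝ) * (N + 1) = (gridCell N x : ℕ) :=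
      div_mul_cancel₀ _ hN.ne'
    have h4 : |(gridPoint N (gridCell N x) - x : ℝ)| * |(N : ℝ) + 1| ≤ 1 := by
      rw [← abs_mul, abs_le]
      constructor <;> linarith
    rwa [abs_of_pos hN, ← le_div_iff₀ hN] at h4

/-! ### Bounds and continuity of the Fredholm series -/

theorem measurable_det_kernel {K : unitInterval → unitInterval → ℝ}
    (hK : Measurable (Function.uncurry K)) (n : ℕ) :
    Measurable fun x : Fin n → unitInterval =>
      (Matrix.of fun p q : Fin n => K (x p) (x q)).det := by
  have h : ∀ p q : Fin n, Measurable fun x : Fin n → unitInterval => Function.uncurry K (x p, x q) :=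
    fun p q => hK.comp ((measurable_pi_apply p).prodMk (measurable_pi_apply q))
  simp only [Matrix.det_apply, Matrix.of_apply]
  refine Finset.measurable_sum _ fun σ _ => ?_
  exact (Finset.measurable_prod _ fun i _ => h (σ i) i).const_smul _

theorem abs_fredholmTerm_le {K : unitInterval → unitInterval → ℝ} {B : ℝ} (hB : 0 ≤ B)
    (hK : ∀ x y, |K x y| ≤ B) (n : ℕ) :
    |fredholmTerm K n| ≤ (√n * B) ^ n / n.factorial := by
  rw [fredholmTerm, abs_mul, abs_of_nonneg (by positivity), one_div, inv_mul_eq_div]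
  gcongr
  have h : ∀ x : Fin n → unitInterval,
      ‖(Matrix.of fun p q : Fin n => K (x p) (x q)).det‖ ≤ (√n * B) ^ n := fun x =>
    Matrix.abs_det_le_of_abs_le _ hB fun _ _ => hK _ _
  refine (norm_integral_le_of_norm_le_const (.of_forall h)).trans ?_
  simp

theorem summable_fredholmTerm {K : unitInterval → unitInterval → ℝ} {B : ℝ} (hB : 0 ≤ B)
    (hK : ∀ x y, |K x y| ≤ B) : Summable (fredholmTerm K) :=
  .of_norm_bounded (summable_sqrt_mul_pow_div_factorial hB) (abs_fredholmTerm_le hB hK)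

/-- Fredholm determinants are continuous under bounded pointwise convergence of kernels. -/
theorem tendsto_fredholmDet {K : ℕ → unitInterval → unitInterval → ℝ}
    {L : unitInterval → unitInterval → ℝ} {B : ℝ} (hB : 0 ≤ B)
    (hmeas : ∀ N, Measurable (Function.uncurry (K N))) (hK : ∀ N x y, |K N x y| ≤ B)
    (hlim : ∀ x y, Tendsto (fun N => K N x y) atTop (𝓝 (L x y))) :
    Tendsto (fun N => fredholmDet (K N)) atTop (𝓝 (fredholmDet L)) := by
  refine tendsto_tsum_of_dominated_convergence (summable_sqrt_mul_pow_div_factorial hB)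
    (fun n => ?_) (.of_forall fun N n => abs_fredholmTerm_le hB (hK N) n)
  refine Tendsto.const_mul _ (tendsto_integral_of_dominated_convergence
    (fun _ => (√n * B) ^ n) (fun N => (measurable_det_kernel (hmeas N) n).aestronglyMeasurable)
    (integrable_const _)
    (fun N => .of_forall fun x => Matrix.abs_det_le_of_abs_le _ hB fun _ _ => hK _ _ _)
    (.of_forall fun x => ?_))
  simp only [Matrix.det_apply, Matrix.of_apply]
  exact tendsto_finsetSum _ fun σ _ =>
    (tendsto_finsetProd _ fun i _ => hlim _ _).const_smul _

/-! ### Triangular kernels and the factored kernel -/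

/-- The kernel `H` cut off above the diagonal. -/
noncomputable def lowerKernel (H : unitInterval → unitInterval → ℝ) (x y : unitInterval) : ℝ :=
  if y ≤ x then H x y else 0

/-- The kernel `H` cut off above the diagonal and halved on the diagonal. -/
noncomputable def halfKernel (H : unitInterval → unitInterval → ℝ) (x y : unitInterval) : ℝ :=
  if y < x then H x y else if y = x then H x y / 2 else 0

/-- The kernel of `T + T* + T T*`, where `T` has the kernel `lowerKernel H`. -/
noncomputable def factoredKernel (H : unitInterval → unitInterval → ℝ) (x y : unitInterval) : ℝ :=
  H x y + ∫ t, lowerKernel H x t * lowerKernel H y t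

section Kernels

variable {H : unitInterval → unitInterval → ℝ} {B : ℝ}

theorem abs_lowerKernel_le (hB : ∀ x y, |H x y| ≤ B) (x y : unitInterval) :
    |lowerKernel H x y| ≤ B := by
  have := hB x y
  rw [lowerKernel]
  split_ifs
  · exact this
  · simpa using (abs_nonneg _).trans this

theorem abs_halfKernel_le (hB : ∀ x y, |H x y| ≤ B) (x y : unitInterval) :
    |halfKernel H x y| ≤ B := by
  have := hB x y
  rw [halfKernel]
  split_ifs
  · exact this
  · rw [abs_div, abs_two]
    linarith [abs_nonneg (H x y)]
  · simpa using (abs_nonneg _).trans this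

theorem measurable_lowerKernel (hH : Continuous (Function.uncurry H)) :
    Measurable (Function.uncurry (lowerKernel H)) :=
  Measurable.ite (measurableSet_le measurable_snd measurable_fst) hH.measurable measurable_const

theorem halfKernel_eq_lowerKernel {x y : unitInterval} (h : x ≠ y) :
    halfKernel H x y = lowerKernel H x y := by
  rcases h.lt_or_gt with h | h
  · simp [halfKernel, lowerKernel, h.not_gt, h.ne', h]
  · simp [halfKernel, lowerKernel, h, h.le]

theorem lowerKernel_add_swap (hs : ∀ x y, H x y = H y x) {x y : unitInterval} (h : x ≠ y) :
    lowerKernel H x y + lowerKernel H y x = H x y := by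
  rcases h.lt_or_gt with h | h
  · simp [lowerKernel, h.le, h.not_ge, hs y x]
  · simp [lowerKernel, h.le, h.not_ge]

/-- The reason for halving: the identity survives on the diagonal, where `lowerKernel` would count
`H` twice. -/
theorem halfKernel_add_swap (hs : ∀ x y, H x y = H y x) (x y : unitInterval) :
    halfKernel H x y + halfKernel H y x = H x y := by
  rcases eq_or_ne x y with rfl | h
  · simp [halfKernel]
  · rw [halfKernel_eq_lowerKernel h, halfKernel_eq_lowerKernel h.symm, lowerKernel_add_swap hs h]

theorem continuousAt_lowerKernel (hH : Continuous (Function.uncurry H)) {x y : unitInterval}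
    (h : x ≠ y) : ContinuousAt (Function.uncurry (lowerKernel H)) (x, y) := by
  rcases h.lt_or_gt with h | h
  · refine (continuousAt_const (y := (0 : ℝ))).congr ?_
    filter_upwards [(isOpen_lt continuous_fst continuous_snd).mem_nhds h] with p hp
    exact (if_neg (not_le.mpr hp)).symm
  · refine hH.continuousAt.congr ?_
    filter_upwards [(isOpen_lt continuous_snd continuous_fst).mem_nhds h] with p hp
    exact (if_pos (le_of_lt hp)).symm

theorem tendsto_halfKernel (hH : Continuous (Function.uncurry H)) {ι : Type*} {l : Filter ι}
    {u v : ι → unitInterval} {x y : unitInterval} (h : x ≠ y) (hu : Tendsto u l (𝓝 x))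
    (hv : Tendsto v l (𝓝 y)) :
    Tendsto (fun i => halfKernel H (u i) (v i)) l (𝓝 (lowerKernel H x y)) := by
  refine ((continuousAt_lowerKernel hH h).tendsto.comp (hu.prodMk_nhds hv)).congr' ?_
  filter_upwards [(hu.prodMk_nhds hv).eventually
    ((isOpen_ne_fun continuous_fst continuous_snd).mem_nhds h)] with i hi
  exact (halfKernel_eq_lowerKernel hi).symm

theorem ae_ne_unitInterval (x : unitInterval) : ∀ᵐ t : unitInterval, x ≠ t := by
  filter_upwards [compl_mem_ae_iff.mpr (measure_singleton (μ := volume) x)] with t ht h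
  exact ht h.symm

/-- The jump of `lowerKernel` affects the integrand near `p` only at `t = p.1` and `t = p.2`, a null
set, so dominated convergence applies. -/
theorem continuous_factoredKernel (hH : Continuous (Function.uncurry H))
    (hB : ∀ x y, |H x y| ≤ B) : Continuous (Function.uncurry (factoredKernel H)) := by
  have hB0 : 0 ≤ B := (abs_nonneg _).trans (hB 0 0)
  refine hH.add (continuous_iff_continuousAt.mpr fun p => ?_)
  refine continuousAt_of_dominated (F := fun (p : unitInterval × unitInterval) t =>
    lowerKernel H p.1 t * lowerKernel H p.2 t) (bound := fun _ => B * B) (.of_forall fun q => ?_)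
    (.of_forall fun q => .of_forall fun t => ?_) (integrable_const _) ?_
  · have hm := measurable_lowerKernel hH
    exact ((hm.comp (measurable_prodMk_left (x := q.1))).mul
      (hm.comp (measurable_prodMk_left (x := q.2)))).aestronglyMeasurable
  · rw [norm_mul]
    exact mul_le_mul (abs_lowerKernel_le hB _ _) (abs_lowerKernel_le hB _ _) (abs_nonneg _) hB0
  · filter_upwards [ae_ne_unitInterval p.1, ae_ne_unitInterval p.2] with t h1 h2
    exact ((continuousAt_lowerKernel hH h1).comp (f := fun q : unitInterval × unitInterval =>
      (q.1, t)) (by fun_prop)).mul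
      ((continuousAt_lowerKernel hH h2).comp (f := fun q : unitInterval × unitInterval =>
      (q.2, t)) (by fun_prop))

end Kernels

/-! ### Identification of the kernel of `A` -/

theorem eq_of_forall_integral_mul_eq {K L : unitInterval → unitInterval → ℝ}
    (hK : Continuous (Function.uncurry K)) (hL : Continuous (Function.uncurry L))
    (h : ∀ f : C(unitInterval, ℝ), ∀ᵐ x : unitInterval, ∫ y, K x y * f y = ∫ y, L x y * f y) :
    K = L := by
  have hcont : ∀ {M : unitInterval → unitInterval → ℝ}, Continuous (Function.uncurry M) →
      ∀ f : C(unitInterval, ℝ), Continuous fun x => ∫ y, M x y * f y := by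
    intro M hM f
    have := continuous_parametric_integral_of_continuous (μ := (volume : Measure unitInterval))
      (f := fun x y => M x y * f y) (hM.mul (f.continuous.comp continuous_snd)) isCompact_univ
    simpa using this
  have hint : ∀ f : unitInterval → ℝ, Continuous f → Integrable f := fun f hf => by
    have := hf.continuousOn.integrableOn_compact (μ := volume) isCompact_univ
    rwa [integrableOn_univ] at this
  have heq : ∀ (f : C(unitInterval, ℝ)) x, ∫ y, K x y * f y = ∫ y, L x y * f y := fun f =>
    congrFun (((hcont hK f).ae_eq_iff_eq volume (hcont hL f)).mp (h f))
  funext x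
  have hKx : Continuous (K x) := hK.comp (Continuous.prodMk_right x)
  have hLx : Continuous (L x) := hL.comp (Continuous.prodMk_right x)
  have hsq : Continuous fun y => (K x y - L x y) ^ 2 := (hKx.sub hLx).pow 2
  have h0 : ∫ y, (K x y - L x y) ^ 2 = 0 := by
    -- For fixed `x`, testing against the difference of the kernels yields the integral of its
    -- square.
    have := heq ⟨fun y => K x y - L x y, hKx.sub hLx⟩ x
    rw [← sub_eq_zero, ← integral_sub (hint _ (by fun_prop)) (hint _ (by fun_prop))] at this
    rw [← this]
    refine integral_congr_ae (.of_forall fun y => ?_)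
    simp only [ContinuousMap.coe_mk]
    ring
  rw [integral_eq_zero_iff_of_nonneg (fun y => sq_nonneg _) (hint _ hsq)] at h0
  have h1 := (Continuous.ae_eq_iff_eq volume hsq continuous_const).mp h0
  funext y
  exact sub_eq_zero.mp (pow_eq_zero_iff two_ne_zero |>.mp (congrFun h1 y))

/-- The adjoint of an integral operator with bounded kernel has the transposed kernel. -/
theorem IsIntegralOperator.adjoint_apply_ae {T : L2I →L[ℝ] L2I}
    {k : unitInterval → unitInterval → ℝ} {B : ℝ} (hT : IsIntegralOperator T k)
    (hk : Measurable (Function.uncurry k)) (hB : ∀ x y, |k x y| ≤ B) (φ : L2I) :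
    ∀ᵐ y : unitInterval, ContinuousLinearMap.adjoint T φ y = ∫ x, k x y * φ x := by
  have hφ : Integrable φ := (Lp.memLp φ).integrable one_le_two
  have hprod : ∀ μ : Measure unitInterval, IsFiniteMeasure μ →
      Integrable (fun p : unitInterval × unitInterval => k p.1 p.2 * φ p.1)
        ((volume : Measure unitInterval).prod μ) := by
    intro μ _
    refine (hφ.comp_fst μ).bdd_mul (c := B) hk.aestronglyMeasurable (.of_forall fun p => hB _ _)
  -- Integrals over measurable sets are pairings with indicators; these move the adjoint back to
  -- `T`, and Fubini finishes.
  refine Integrable.ae_eq_of_forall_setIntegral_eq _ _ ((Lp.memLp _).integrable one_le_two)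
    (hprod volume inferInstance).integral_prod_right fun s hs _ => ?_
  rw [← L2.inner_indicatorConstLp_one (𝕜 := ℝ) hs (measure_ne_top _ _),
    ContinuousLinearMap.adjoint_inner_right, L2.inner_def]
  have h1 : ∀ᵐ x : unitInterval, T (indicatorConstLp 2 hs (measure_ne_top _ _) (1 : ℝ)) x =
      ∫ y in s, k x y := by
    filter_upwards [hT.apply_ae (indicatorConstLp 2 hs (measure_ne_top _ _) (1 : ℝ))] with x hx
    rw [hx, ← integral_indicator hs]
    refine integral_congr_ae ?_
    filter_upwards [indicatorConstLp_coeFn (p := 2) (hs := hs)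
      (hμs := measure_ne_top (volume : Measure unitInterval) s) (c := (1 : ℝ))] with y hy
    rw [hy]
    by_cases hys : y ∈ s <;> simp [hys]
  calc _ = ∫ x, ∫ y in s, k x y * φ x := by
        refine integral_congr_ae ?_
        filter_upwards [h1] with x hx
        rw [hx, integral_mul_const]
        simp [mul_comm]
    _ = _ := integral_integral_swap (hprod (volume.restrict s) inferInstance)

theorem kernel_eq_factoredKernel {A T : L2I →L[ℝ] L2I} {kA H : unitInterval → unitInterval → ℝ}
    (hA : IsIntegralOperator A kA) (hkA : Continuous (Function.uncurry kA))
    (hH : Continuous (Function.uncurry H)) (hs : ∀ x y, H x y = H y x) {B : ℝ}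
    (hB : ∀ x y, |H x y| ≤ B) (hT : IsIntegralOperator T (lowerKernel H))
    (hdec : ContinuousLinearMap.id ℝ L2I + A =
      (ContinuousLinearMap.id ℝ L2I + T) ∘L
        (ContinuousLinearMap.id ℝ L2I + ContinuousLinearMap.adjoint T)) :
    kA = factoredKernel H := by
  have hB0 : 0 ≤ B := (abs_nonneg _).trans (hB 0 0)
  have hm := measurable_lowerKernel hH
  have hl := abs_lowerKernel_le hB
  refine eq_of_forall_integral_mul_eq hkA (continuous_factoredKernel hH hB) fun f => ?_
  set φ : L2I := ContinuousMap.toLp 2 volume ℝ f with hφdef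
  have hφ : φ =ᵐ[volume] f := ContinuousMap.coeFn_toLp volume f
  have hf : Integrable f := ((Lp.memLp φ).integrable one_le_two).congr hφ
  have hAφ : A φ = T φ + ContinuousLinearMap.adjoint T φ +
      T (ContinuousLinearMap.adjoint T φ) := by
    have h := congrArg (fun S : L2I →L[ℝ] L2I => S φ) hdec
    simp only [_root_.add_apply, ContinuousLinearMap.comp_apply,
      ContinuousLinearMap.id_apply, map_add] at h
    rw [← add_right_inj φ, h]
    abel
  have hcong : ∀ g : unitInterval → ℝ, ∫ y, g y * φ y = ∫ y, g y * f y := fun g =>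
    integral_congr_ae (by filter_upwards [hφ] with y hy; rw [hy])
  have hadj := hT.adjoint_apply_ae hm hl φ
  filter_upwards [hA.apply_ae φ, hT.apply_ae φ, hadj,
    hT.apply_ae (ContinuousLinearMap.adjoint T φ),
    Lp.coeFn_add (T φ + ContinuousLinearMap.adjoint T φ) (T (ContinuousLinearMap.adjoint T φ)),
    Lp.coeFn_add (T φ) (ContinuousLinearMap.adjoint T φ)] with x h1 h2 h3 h4 h5 h6
  rw [← hcong, ← h1, hAφ, h5, Pi.add_apply, h6, Pi.add_apply, h2, h3, h4, hcong, hcong]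
  have hx : Measurable (lowerKernel H x) := hm.comp measurable_prodMk_left
  have hx' : Measurable fun y => lowerKernel H y x := hm.comp measurable_prodMk_right
  have i1 : Integrable fun y => lowerKernel H x y * f y :=
    hf.bdd_mul hx.aestronglyMeasurable (.of_forall (hl x))
  have i2 : Integrable fun y => lowerKernel H y x * f y :=
    hf.bdd_mul hx'.aestronglyMeasurable (.of_forall fun y => hl y x)
  have i3 : Integrable (fun p : unitInterval × unitInterval =>
      lowerKernel H x p.1 * lowerKernel H p.2 p.1 * f p.2)
      ((volume : Measure unitInterval).prod volume) := by
    refine (hf.comp_snd volume).bdd_mul (c := B * B)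
      ((hx.comp measurable_fst).mul (hm.comp measurable_swap)).aestronglyMeasurable
      (.of_forall fun p => ?_)
    rw [norm_mul]
    exact mul_le_mul (hl _ _) (hl _ _) (abs_nonneg _) hB0
  have h7 : ∫ t, lowerKernel H x t * ContinuousLinearMap.adjoint T φ t =
      ∫ y, (∫ t, lowerKernel H x t * lowerKernel H y t) * f y := by
    calc _ = ∫ t, ∫ y, lowerKernel H x t * lowerKernel H y t * f y := by
          refine integral_congr_ae ?_
          filter_upwards [hadj] with t ht
          rw [ht, hcong, ← integral_const_mul]
          simp only [mul_assoc]
      _ = ∫ y, ∫ t, lowerKernel H x t * lowerKernel H y t * f y := integral_integral_swap i3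
      _ = _ := by simp only [integral_mul_const]
  have i4 : Integrable fun y => (∫ t, lowerKernel H x t * lowerKernel H y t) * f y := by
    have := i3.integral_prod_right
    simpa only [integral_mul_const] using this
  rw [h7, ← integral_add i1 i2]
  refine (integral_add (i1.add i2) i4).symm.trans ?_
  refine integral_congr_ae ?_
  -- The kernels of `T` and `T*` add up to `H` only off the diagonal, which suffices under the
  -- integral.
  filter_upwards [ae_ne_unitInterval x] with y hy
  rw [factoredKernel, ← lowerKernel_add_swap hs hy, Pi.add_apply]
  ring

/-! ### Discretization and passage to the limit -/

theorem abs_log_one_add_sub_le {u : ℝ} (hu : |u| ≤ 1 / 2) : |Real.log (1 + u) - u| ≤ 2 * u ^ 2 := by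
  have h := Real.abs_log_sub_add_sum_range_le (x := -u) (by rw [abs_neg]; linarith) 1
  simp only [Finset.sum_range_one, abs_neg, sub_neg_eq_add] at h
  norm_num at h
  rw [neg_add_eq_sub] at h
  refine h.trans ?_
  rw [div_le_iff₀ (by linarith)]
  nlinarith [sq_nonneg u]

section Discretization

variable {H : unitInterval → unitInterval → ℝ} {B : ℝ}

/-- The matrix of values of `halfKernel H` on the uniform grid. -/
noncomputable def halfMatrix (H : unitInterval → unitInterval → ℝ) (N : ℕ) :
    Matrix (Fin (N + 1)) (Fin (N + 1)) ℝ :=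
  Matrix.of fun i j => halfKernel H (gridPoint N i) (gridPoint N j)

/-- The discrete analogue of `factoredKernel H` on the uniform grid. -/
noncomputable def factoredMatrix (H : unitInterval → unitInterval → ℝ) (N : ℕ) :
    Matrix (Fin (N + 1)) (Fin (N + 1)) ℝ :=
  halfMatrix H N + (halfMatrix H N).transpose +
    ((N : ℝ) + 1)⁻¹ • (halfMatrix H N * (halfMatrix H N).transpose)

theorem one_add_smul_factoredMatrix (H : unitInterval → unitInterval → ℝ) (N : ℕ) :
    1 + ((N : ℝ) + 1)⁻¹ • factoredMatrix H N =
      (1 + ((N : ℝ) + 1)⁻¹ • halfMatrix H N) *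
        (1 + ((N : ℝ) + 1)⁻¹ • halfMatrix H N).transpose := by
  rw [factoredMatrix]
  simp only [Matrix.transpose_add, Matrix.transpose_one, Matrix.transpose_smul, add_mul, mul_add,
    one_mul, mul_one, smul_add, smul_mul_assoc, mul_smul_comm]
  abel

theorem det_one_add_smul_halfMatrix (H : unitInterval → unitInterval → ℝ) (N : ℕ) (c : ℝ) :
    (1 + c • halfMatrix H N).det =
      ∏ i, (1 + c * (H (gridPoint N i) (gridPoint N i) / 2)) := by
  rw [Matrix.det_of_isLowerTriangular]
  · simp [halfMatrix, halfKernel]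
  · intro i j hij
    have hij : i < j := hij
    have h := gridPoint_strictMono N hij
    simp [halfMatrix, halfKernel, h.not_gt, h.ne', hij.ne]

/-- The weighted matrix product is the integral of a step function, which makes the matrix a
discrete `factoredKernel`. -/
theorem factoredMatrix_gridCell (hs : ∀ x y, H x y = H y x) (N : ℕ) (x y : unitInterval) :
    factoredMatrix H N (gridCell N x) (gridCell N y) =
      H (gridPoint N (gridCell N x)) (gridPoint N (gridCell N y)) +
        ∫ t, halfKernel H (gridPoint N (gridCell N x)) (gridPoint N (gridCell N t)) *
          halfKernel H (gridPoint N (gridCell N y)) (gridPoint N (gridCell N t)) := by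
  rw [integral_comp_gridCell N fun k =>
    halfKernel H (gridPoint N (gridCell N x)) (gridPoint N k) *
      halfKernel H (gridPoint N (gridCell N y)) (gridPoint N k), ← halfKernel_add_swap hs]
  simp [factoredMatrix, halfMatrix, Matrix.mul_apply]

theorem fredholmDet_factoredMatrix (H : unitInterval → unitInterval → ℝ) (N : ℕ) :
    fredholmDet (fun x y => factoredMatrix H N (gridCell N x) (gridCell N y)) =
      (∏ i, (1 + ((N : ℝ) + 1)⁻¹ * (H (gridPoint N i) (gridPoint N i) / 2))) ^ 2 := by
  rw [fredholmDet_gridCell, one_add_smul_factoredMatrix, Matrix.det_mul, Matrix.det_transpose,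
    det_one_add_smul_halfMatrix, sq]

theorem tendsto_fredholmDet_factoredMatrix (hH : Continuous (Function.uncurry H))
    (hs : ∀ x y, H x y = H y x) (hB : ∀ x y, |H x y| ≤ B) :
    Tendsto
      (fun N => fredholmDet (fun x y => factoredMatrix H N (gridCell N x) (gridCell N y))) atTop
      (𝓝 (fredholmDet (factoredKernel H))) := by
  have hB0 : 0 ≤ B := (abs_nonneg _).trans (hB 0 0)
  have hhalf := abs_halfKernel_le hB
  have hmul : ∀ x y t t' : unitInterval, ‖halfKernel H x t * halfKernel H y t'‖ ≤ B * B := by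
    intro x y t t'
    rw [norm_mul]
    exact mul_le_mul (hhalf _ _) (hhalf _ _) (abs_nonneg _) hB0
  refine tendsto_fredholmDet (K := fun N x y => factoredMatrix H N (gridCell N x) (gridCell N y))
    (B := B + B * B) (by positivity) (fun N => ?_) (fun N x y => ?_)
    fun x y => ?_
  · have hM : Measurable fun p : Fin (N + 1) × Fin (N + 1) => factoredMatrix H N p.1 p.2 :=
      measurable_of_finite _
    have hcell : Measurable fun p : unitInterval × unitInterval =>
        (gridCell N p.1, gridCell N p.2) :=
      ((measurable_gridCell N).comp measurable_fst).prodMk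
        ((measurable_gridCell N).comp measurable_snd)
    have hcomp := hM.comp hcell
    exact hcomp
  · rw [factoredMatrix_gridCell hs]
    refine (abs_add_le _ _).trans (add_le_add (hB _ _) ?_)
    refine (norm_integral_le_of_norm_le_const (.of_forall fun t => hmul _ _ _ _)).trans ?_
    simp
  · simp only [factoredMatrix_gridCell hs]
    refine ((hH.tendsto (x, y)).comp ((tendsto_gridPoint_gridCell x).prodMk_nhds
      (tendsto_gridPoint_gridCell y))).add ?_
    refine tendsto_integral_of_dominated_convergence (fun _ => B * B) (fun N => ?_)
      (integrable_const _) (fun N => .of_forall fun t => hmul _ _ _ _) ?_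
    · exact ((measurable_of_finite fun k => halfKernel H (gridPoint N (gridCell N x))
        (gridPoint N k) * halfKernel H (gridPoint N (gridCell N y)) (gridPoint N k)).comp
        (measurable_gridCell N)).aestronglyMeasurable
    -- The halved diagonal plays no role in the limit: it could matter only at `t = x` or `t = y`.
    · filter_upwards [ae_ne_unitInterval x, ae_ne_unitInterval y] with t hx hy
      exact (tendsto_halfKernel hH hx (tendsto_gridPoint_gridCell x)
        (tendsto_gridPoint_gridCell t)).mul (tendsto_halfKernel hH hy
        (tendsto_gridPoint_gridCell y) (tendsto_gridPoint_gridCell t))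

theorem tendsto_riemannSum {h : unitInterval → ℝ} (hh : Continuous h) (hB : ∀ x, |h x| ≤ B) :
    Tendsto (fun N : ℕ => ((N : ℝ) + 1)⁻¹ * ∑ i, h (gridPoint N i)) atTop (𝓝 (∫ t, h t)) := by
  simp only [← fun N => integral_comp_gridCell N fun i => h (gridPoint N i)]
  refine tendsto_integral_of_dominated_convergence (fun _ => B) (fun N => ?_)
    (integrable_const _) (fun N => .of_forall fun t => hB _) (.of_forall fun t => ?_)
  · exact ((measurable_of_finite fun k => h (gridPoint N k)).comp
      (measurable_gridCell N)).aestronglyMeasurable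
  · exact (hh.tendsto t).comp (tendsto_gridPoint_gridCell t)

/-- The square cancels the half: `2 ∑ log (1 + c h/2)` differs from the Riemann sum `c ∑ h` by at
most `2 (N+1) c² B²/2 = c B²`, which tends to `0`. -/
theorem tendsto_prod_one_add_sq {h : unitInterval → ℝ} (hh : Continuous h)
    (hB : ∀ x, |h x| ≤ B) :
    Tendsto (fun N : ℕ => (∏ i, (1 + ((N : ℝ) + 1)⁻¹ * (h (gridPoint N i) / 2))) ^ 2) atTop
      (𝓝 (Real.exp (∫ t, h t))) := by
  have hc : Tendsto (fun N : ℕ => ((N : ℝ) + 1)⁻¹) atTop (𝓝 0) := by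
    simpa using tendsto_one_div_add_atTop_nhds_zero_nat (𝕜 := ℝ)
  have hu : ∀ᶠ N : ℕ in atTop, ((N : ℝ) + 1)⁻¹ * B ≤ 1 := by
    have := hc.mul_const B
    rw [zero_mul] at this
    exact this.eventually_le_const zero_lt_one
  have hsmall : ∀ N : ℕ, ((N : ℝ) + 1)⁻¹ * B ≤ 1 → ∀ i,
      |((N : ℝ) + 1)⁻¹ * (h (gridPoint N i) / 2)| ≤ 1 / 2 := by
    intro N hN i
    have hcpos : (0 : ℝ) < ((N : ℝ) + 1)⁻¹ := by positivity
    rw [abs_mul, abs_of_pos hcpos, abs_div, abs_two]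
    have := mul_le_mul_of_nonneg_left (hB (gridPoint N i)) hcpos.le
    linarith
  have hlog : Tendsto (fun N : ℕ =>
      2 * ∑ i, Real.log (1 + ((N : ℝ) + 1)⁻¹ * (h (gridPoint N i) / 2))) atTop
      (𝓝 (∫ t, h t)) := by
    have hdiff : Tendsto (fun N : ℕ =>
        2 * ∑ i, Real.log (1 + ((N : ℝ) + 1)⁻¹ * (h (gridPoint N i) / 2)) -
          ((N : ℝ) + 1)⁻¹ * ∑ i, h (gridPoint N i)) atTop (𝓝 0) := by
      have hb := hc.mul_const (B ^ 2)
      rw [zero_mul] at hb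
      refine squeeze_zero_norm' ?_ hb
      filter_upwards [hu] with N hN
      have heq : 2 * ∑ i, Real.log (1 + ((N : ℝ) + 1)⁻¹ * (h (gridPoint N i) / 2)) -
          ((N : ℝ) + 1)⁻¹ * ∑ i, h (gridPoint N i) =
          2 * ∑ i, (Real.log (1 + ((N : ℝ) + 1)⁻¹ * (h (gridPoint N i) / 2)) -
            ((N : ℝ) + 1)⁻¹ * (h (gridPoint N i) / 2)) := by
        rw [Finset.sum_sub_distrib, ← Finset.mul_sum, ← Finset.sum_div]
        ring
      have hterm : ∀ i, |Real.log (1 + ((N : ℝ) + 1)⁻¹ * (h (gridPoint N i) / 2)) -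
          ((N : ℝ) + 1)⁻¹ * (h (gridPoint N i) / 2)| ≤ (((N : ℝ) + 1)⁻¹) ^ 2 * B ^ 2 / 2 := by
        intro i
        refine (abs_log_one_add_sub_le (hsmall N hN i)).trans ?_
        have : h (gridPoint N i) ^ 2 ≤ B ^ 2 := sq_le_sq.mpr ((hB _).trans (le_abs_self B))
        have := mul_le_mul_of_nonneg_left this (sq_nonneg ((N : ℝ) + 1)⁻¹)
        nlinarith
      rw [heq, Real.norm_eq_abs, abs_mul, abs_two]
      calc _ ≤ 2 * ∑ _i : Fin (N + 1), (((N : ℝ) + 1)⁻¹) ^ 2 * B ^ 2 / 2 := by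
            gcongr
            exact (Finset.abs_sum_le_sum_abs _ _).trans (Finset.sum_le_sum fun i _ => hterm i)
        _ = ((N : ℝ) + 1)⁻¹ * B ^ 2 := by
            simp only [Finset.sum_const, Finset.card_univ, Fintype.card_fin, nsmul_eq_mul]
            push_cast
            field_simp
    simpa using hdiff.add (tendsto_riemannSum hh hB)
  refine ((Real.continuous_exp.tendsto _).comp hlog).congr' ?_
  filter_upwards [hu] with N hN
  have hpos : ∀ i, 0 < 1 + ((N : ℝ) + 1)⁻¹ * (h (gridPoint N i) / 2) := fun i => by
    linarith [(abs_le.mp (hsmall N hN i)).1]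
  rw [Function.comp_apply, two_mul, Real.exp_add, Real.exp_sum, ← sq]
  simp only [Real.exp_log (hpos _)]

theorem fredholmDet_factoredKernel (hH : Continuous (Function.uncurry H))
    (hs : ∀ x y, H x y = H y x) (hB : ∀ x y, |H x y| ≤ B) :
    fredholmDet (factoredKernel H) = Real.exp (∫ t, H t t) := by
  have hdiag : Continuous fun t => H t t := hH.comp (continuous_id.prodMk continuous_id)
  have hlim := tendsto_fredholmDet_factoredMatrix hH hs hB
  have hlim' := tendsto_prod_one_add_sq hdiag fun x => hB x x
  have heq := fredholmDet_factoredMatrix H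
  simp only [heq] at hlim
  exact tendsto_nhds_unique hlim hlim'

end Discretization

/-! ### Conclusion -/

theorem exists_abs_le_of_continuous {K : unitInterval → unitInterval → ℝ}
    (hK : Continuous (Function.uncurry K)) : ∃ B, ∀ x y, |K x y| ≤ B := by
  obtain ⟨B, hB⟩ := isCompact_univ.exists_bound_of_continuousOn hK.continuousOn
  exact ⟨B, fun x y => hB (x, y) (Set.mem_univ _)⟩

theorem theorem1
    (A T : L2I →L[ℝ] L2I) (kA kT : unitInterval → unitInterval → ℝ)
    (hA : IsIntegralOperator A kA)
    (hkA : Continuous (Function.uncurry kA))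
    (hT : IsIntegralOperator T kT)
    (htri : IsTriangularKernel kT)
    (hkT : ContinuousOn (Function.uncurry kT) {p : unitInterval × unitInterval | p.2 ≤ p.1})
    (hdec : ContinuousLinearMap.id ℝ L2I + A =
      (ContinuousLinearMap.id ℝ L2I + T) ∘L
        (ContinuousLinearMap.id ℝ L2I + ContinuousLinearMap.adjoint T)) :
    Summable (fredholmTerm kA) ∧ 0 < fredholmDet kA ∧
      Real.log (fredholmDet kA) = ∫ t : unitInterval, kT t t := by
  -- The point `(max x y, min x y)` always lies in the closed triangle, so reflecting `kT` across
  -- the diagonal is continuous on the whole square.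
  let H : unitInterval → unitInterval → ℝ := fun x y => kT (max x y) (min x y)
  have hH : Continuous (Function.uncurry H) :=
    hkT.comp_continuous (f := fun p : unitInterval × unitInterval => (max p.1 p.2, min p.1 p.2))
      (by fun_prop) fun p => min_le_max (a := p.1) (b := p.2)
  have hs : ∀ x y, H x y = H y x := fun x y => by simp only [H, max_comm x y, min_comm x y]
  have hlower : kT = lowerKernel H := by
    funext x y
    rw [lowerKernel]
    split_ifs with h
    · simp only [H, max_eq_left h, min_eq_right h]
    · exact htri x y (not_le.mp h)
  have hdiag : ∀ t, H t t = kT t t := fun t => by simp [H]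
  obtain ⟨B, hB⟩ := exists_abs_le_of_continuous hH
  obtain ⟨C, hC⟩ := exists_abs_le_of_continuous hkA
  have hdet : fredholmDet kA = Real.exp (∫ t, kT t t) := by
    rw [kernel_eq_factoredKernel hA hkA hH hs hB (hlower ▸ hT) hdec,
      fredholmDet_factoredKernel hH hs hB]
    simp only [hdiag]
  exact ⟨summable_fredholmTerm ((abs_nonneg _).trans (hC 0 0)) hC,
    hdet ▸ Real.exp_pos _, by rw [hdet, Real.log_exp]⟩
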